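/- Setting. Fix $d,K\in\mathbb N$ and a measurable merit function $f:\mathbb R\to(0,\infty)$. A parameter $\mu^\star\in\mathbb R^d$ has independent $\mathcal N(0,1)$ coordinates. In each round $t=1,2,\dots$, given the history $H_t$ (contexts, policies, arms and rewards of all earlier rounds): - the environment presents contexts $x_{t,1},\dots,x_{t,K}\in\mathbb R^d$ with $\|x_{t,a}\|_2\le 1$ for all $a$ (almost surely). They are drawn from an arbitrary probability kernel given $H_t$; so they may be fixed or random and may depend on the history, but, given $H_t$, they do not depend on $\mu^\star$; - FairX-LinTS draws $\mu_t$ from the posterior (the conditional law of $\mu^\star$ given $H_t$), conditionally independently of $\mu^\star$ and of the current contexts given $H_t$, and deploys the policy $\pi_t(a)=f(\mu_t\cdot x_{t,a})/\sum_{a'}f(\mu_t\cdot x_{t,a'})$; - an arm $a_t\sim\pi_t$ is drawn, and the reward $r_t=\mu^\star\cdot x_{t,a_t}+\eta_t$ is observed, where $\eta_t\sim\mathcal N(0,1)$ is independent of $\mu^\star$, $H_t$, the current contexts, $\mu_t$ and $a_t$. Let $\pi^\star_t(a)=f(\mu^\star\cdot x_{t,a})/\sum_{a'}f(\mu^\star\cdot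 x_{t,a'})$ be the optimal fair policy. The reward regret is $$RR_T=\sum_{t=1}^T\sum_{a=1}^K\pi^\star_t(a)\,\mu^\star\cdot x_{t,a}-\sum_{t=1}^T\sum_{a=1}^K\pi_t(a)\,\mu^\star\cdot x_{t,a},$$ and the Bayesian reward regret is $\mathrm{BayesRR}_T=\mathbb E_{\mu^\star}\big[\mathbb E[RR_T\mid\mu^\star]\big]=\mathbb E[RR_T]$. Theorem (FairX-LinTS reward regret). $\mathrm{BayesRR}_T=\widetilde O(d\sqrt T)$. Explicitly, there are absolute constants $C\in\mathbb R$ and $p\in\mathbb N$ such that for all $d$, $K$, $f$, all such environments and all $T\ge 1$ (with $d\ge1$), $RR_T$ is integrable and $$|\mathrm{BayesRR}_T|\le C\,d\sqrt T\,\big(1+\ln(dT)\big)^p.$$ -/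

import Mathlib

open MeasureTheory ProbabilityTheory
open scoped RealInnerProductSpace

noncomputable section

namespace FairX

/-- The parameter space `ℝ^d` with the Euclidean norm and inner product. -/
abbrev Param (d : ℕ) : Type := EuclideanSpace ℝ (Fin d)

/-- The context vectors of the `K` arms available in one round. -/
abbrev Contexts (d K : ℕ) : Type := Fin K → Param d

/-- What is recorded about one round: the contexts, the deployed policy, the chosen arm and the
observed reward. -/
abbrev Round (d K : ℕ) : Type := Contexts d K × (Fin K → ℝ) × Fin K × ℝ

/-- The interaction history before round `t`. Rounds are numbered from `0`. -/
abbrev History (d K t : ℕ) : Type := Fin t → Round d K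

/-- The fair policy for the parameter `θ`: arm `a` is played with probability proportional to the
merit `f (θ ⬝ x a)` of its mean reward. -/
def fairPolicy {d K : ℕ} (f : ℝ → ℝ) (θ : Param d) (x : Contexts d K) (a : Fin K) : ℝ :=
  f ⟪θ, x a⟫ / ∑ b, f ⟪θ, x b⟫

/-- The random quantities of one run of FairX-LinTS: the true parameter and, for every round, the
contexts, the parameter sampled by the learner, the chosen arm and the observed reward. -/
structure Run (d K : ℕ) (Ω : Type*) where
  trueParam : Ω → Param d
  context : ℕ → Ω → Contexts d K
  sample : ℕ → Ω → Param d
  arm : ℕ → Ω → Fin K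
  reward : ℕ → Ω → ℝ

namespace Run

variable {d K : ℕ} {Ω : Type*}

/-- The deployed policy: the fair policy of the sampled parameter. -/
def policy (f : ℝ → ℝ) (R : Run d K Ω) (t : ℕ) (ω : Ω) : Fin K → ℝ :=
  fairPolicy f (R.sample t ω) (R.context t ω)

/-- The optimal fair policy: the fair policy of the true parameter. -/
def optPolicy (f : ℝ → ℝ) (R : Run d K Ω) (t : ℕ) (ω : Ω) : Fin K → ℝ :=
  fairPolicy f (R.trueParam ω) (R.context t ω)

/-- The history before round `t`. It does not contain the sampled or the true parameters. -/
def history (f : ℝ → ℝ) (R : Run d K Ω) (t : ℕ) (ω : Ω) : History d K t :=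
  fun s => (R.context s ω, R.policy f s ω, R.arm s ω, R.reward s ω)

/-- The noise `η_t = r_t - μ⋆ ⬝ x_{t, a_t}`. -/
def noise (R : Run d K Ω) (t : ℕ) (ω : Ω) : ℝ :=
  R.reward t ω - ⟪R.trueParam ω, R.context t ω (R.arm t ω)⟫

/-- The posterior of the true parameter given the history before round `t`. -/
def posteriorKernel [MeasurableSpace Ω] (P : Measure Ω) [IsFiniteMeasure P]
    (f : ℝ → ℝ) (R : Run d K Ω) (t : ℕ) : Kernel (History d K t) (Param d) :=
  condDistrib R.trueParam (R.history f t) P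

/-- The reward regret after `T` rounds. -/
def rewardRegret (f : ℝ → ℝ) (R : Run d K Ω) (T : ℕ) (ω : Ω) : ℝ :=
  ∑ t ∈ Finset.range T, ∑ a, R.optPolicy f t ω a * ⟪R.trueParam ω, R.context t ω a⟫
    - ∑ t ∈ Finset.range T, ∑ a, R.policy f t ω a * ⟪R.trueParam ω, R.context t ω a⟫

/-- The Bayesian reward regret: the expectation of the reward regret over the prior, the contexts,
the samples, the arms and the noise. -/
def bayesRewardRegret [MeasurableSpace Ω] (P : Measure Ω)
    (f : ℝ → ℝ) (R : Run d K Ω) (T : ℕ) : ℝ :=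
  ∫ ω, R.rewardRegret f T ω ∂P

/-- `R` is a run of FairX-LinTS with merit function `f`, standard Gaussian prior and standard
Gaussian noise, in an environment that draws the contexts of round `t` from the kernel `env t`
given the history before round `t`. The fields `trueParam_law` to `noise_indep` give the law of the
true parameter and then, in the order of the protocol, the conditional law of each new random
quantity given the true parameter and everything observed or drawn before it in the round. -/
structure IsFairXLinTS [MeasurableSpace Ω] (P : Measure Ω) [IsProbabilityMeasure P]
    (f : ℝ → ℝ) (env : (t : ℕ) → Kernel (History d K t) (Contexts d K))
    (R : Run d K Ω) : Prop where
  measurable_trueParam : Measurable R.trueParam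
  measurable_context : ∀ t, Measurable (R.context t)
  measurable_sample : ∀ t, Measurable (R.sample t)
  measurable_arm : ∀ t, Measurable (R.arm t)
  measurable_reward : ∀ t, Measurable (R.reward t)
  /-- The coordinates of the true parameter are independent with law `N(0, 1)`. -/
  trueParam_law : HasLaw R.trueParam (stdGaussian (Param d)) P
  /-- The contexts depend on the past only through the history. -/
  context_law : ∀ t, HasCondDistrib (R.context t)
    (fun ω => (R.trueParam ω, R.history f t ω))
    (Kernel.prodMkLeft (Param d) (env t)) P
  /-- The learner samples a parameter from the posterior given the history. -/
  sample_law : ∀ t, HasCondDistrib (R.sample t)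
    (fun ω => (R.trueParam ω, R.history f t ω, R.context t ω))
    (Kernel.prodMkLeft (Param d) (Kernel.prodMkRight (Contexts d K) (R.posteriorKernel P f t))) P
  /-- The arm is drawn from the deployed policy. -/
  arm_law : ∀ t a, P⟦R.arm t ⁻¹' {a} | MeasurableSpace.comap
      (fun ω => (R.trueParam ω, R.history f t ω, R.context t ω, R.sample t ω)) inferInstance⟧
    =ᵐ[P] fun ω => R.policy f t ω a
  /-- The noise is standard Gaussian ... -/
  noise_law : ∀ t, HasLaw (R.noise t) (gaussianReal 0 1) P
  /-- ... and independent of all that precedes it. -/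
  noise_indep : ∀ t, IndepFun (R.noise t) (fun ω =>
    (R.trueParam ω, R.history f t ω, R.context t ω, R.sample t ω, R.arm t ω)) P

end Run

end FairX

end

/-! Given the history and the contexts, the sampled and the true parameter have the same conditional
law. The optimal fair reward therefore has the same mean as the reward the learner expects under its
own sample, and the expected regret of a round is the mean of `π_t`-averages of `(μ_t - μ⋆) ⬝ x`.
The merit function enters only through the weights of these averages, so no regularity of it is
needed.

With `V` the regularized Gram matrix, weighted Cauchy-Schwarz for the form of `V⁻¹` bounds each
difference by `l (Q(μ_t) + Q(μ⋆)) / 2 + l⁻¹ w(x)`, where `Q` is the ridge error and `w` the width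
(`abs_inner_sub_inner_le`). Posterior matching gives `Q(μ_t)` and `Q(μ⋆)` the same mean, and drawing
the arm from `π_t` turns the averaged width into the mean width of the played context.

Both means are controlled without confidence sets. By Sherman-Morrison, a round changes `Q(μ⋆)` by
at most a term linear in the fresh noise, of mean zero, and a quadratic one whose mean is at most
the mean width; since `Q(μ⋆)` starts at `‖μ⋆‖²`, its mean is at most `d` plus the accumulated widths
(`integral_ridgeError_le`). These sum to `O(d log (d + T))` by the elliptical potential argument
(`sum_width_le`). Taking `l = 1 / √T` balances the two contributions. -/

open scoped ENNReal

/-! ### Quadratic forms of inverse matrices under rank-one updates -/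

namespace Matrix

variable {n : Type*} [Fintype n] [DecidableEq n]

theorem PosDef.quadForm_inv_nonneg {V : Matrix n n ℝ} (hV : V.PosDef) (x : n → ℝ) :
    0 ≤ x ⬝ᵥ V⁻¹ *ᵥ x := by
  simpa using hV.inv.posSemidef.dotProduct_mulVec_nonneg x

theorem PosDef.dotProduct_inv_mulVec_comm {V : Matrix n n ℝ} (hV : V.PosDef) (x y : n → ℝ) :
    x ⬝ᵥ V⁻¹ *ᵥ y = y ⬝ᵥ V⁻¹ *ᵥ x := by
  have h : (V⁻¹)ᵀ = V⁻¹ := by simpa using hV.inv.isHermitian.eq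
  rw [dotProduct_mulVec, ← mulVec_transpose, h, dotProduct_comm]

/-- Weighted Cauchy-Schwarz inequality for the form of `V⁻¹`. -/
theorem PosDef.abs_dotProduct_inv_mulVec_le {V : Matrix n n ℝ} (hV : V.PosDef) (x y : n → ℝ)
    {l : ℝ} (hl : 0 < l) :
    |x ⬝ᵥ V⁻¹ *ᵥ y| ≤ (l * (x ⬝ᵥ V⁻¹ *ᵥ x) + l⁻¹ * (y ⬝ᵥ V⁻¹ *ᵥ y)) / 2 := by
  -- The form is nonnegative at `l x + c y`; divide by `l`. The choices `c = ±1` bound the mixed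
  -- term from both sides.
  have key : ∀ c : ℝ, 0 ≤ l * (x ⬝ᵥ V⁻¹ *ᵥ x) + 2 * c * (x ⬝ᵥ V⁻¹ *ᵥ y)
      + c ^ 2 * l⁻¹ * (y ⬝ᵥ V⁻¹ *ᵥ y) := by
    intro c
    have h := hV.quadForm_inv_nonneg (l • x + c • y)
    simp only [mulVec_add, mulVec_smul, dotProduct_add, add_dotProduct, dotProduct_smul,
      smul_dotProduct, smul_eq_mul, hV.dotProduct_inv_mulVec_comm y x] at h
    have h2 := mul_nonneg (inv_pos.2 hl).le h
    have : l⁻¹ * l = 1 := inv_mul_cancel₀ hl.ne'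
    linear_combination h2 + (l * (x ⬝ᵥ V⁻¹ *ᵥ x) + 2 * c * (x ⬝ᵥ V⁻¹ *ᵥ y)) * this
  have h1 := key 1
  have h2 := key (-1)
  rw [abs_le]
  constructor <;> linarith

theorem PosDef.det_add_vecMulVec_self {V : Matrix n n ℝ} (hV : V.PosDef) (x : n → ℝ) :
    (V + vecMulVec x x).det = V.det * (1 + x ⬝ᵥ V⁻¹ *ᵥ x) := by
  have h := det_add_replicateCol_mul_replicateRow (ι := Unit) (isUnit_iff_ne_zero.2 hV.det_pos.ne')
    x x
  rw [vecMulVec_eq Unit, h]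
  congr 1
  simp [det_unique, mul_apply, dotProduct, mulVec, Finset.sum_mul, Finset.mul_sum]
  rw [Finset.sum_comm]
  simp only [mul_assoc]

/-- The Sherman-Morrison formula. -/
theorem PosDef.inv_add_vecMulVec_self {V : Matrix n n ℝ} (hV : V.PosDef) (x : n → ℝ) :
    (V + vecMulVec x x)⁻¹ =
      V⁻¹ - (1 + x ⬝ᵥ V⁻¹ *ᵥ x)⁻¹ • vecMulVec (V⁻¹ *ᵥ x) (V⁻¹ *ᵥ x) := by
  have hu : IsUnit V.det := isUnit_iff_ne_zero.2 hV.det_pos.ne'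
  have hT : (V⁻¹)ᵀ = V⁻¹ := by simpa using hV.inv.isHermitian.eq
  have hpos : 0 < 1 + x ⬝ᵥ V⁻¹ *ᵥ x := by
    have := hV.quadForm_inv_nonneg x
    linarith
  refine inv_eq_right_inv ?_
  have e1 : vecMulVec x x * V⁻¹ = vecMulVec x (V⁻¹ *ᵥ x) := by
    rw [vecMulVec_mul, ← mulVec_transpose, hT]
  have e2 : V * vecMulVec (V⁻¹ *ᵥ x) (V⁻¹ *ᵥ x) = vecMulVec x (V⁻¹ *ᵥ x) := by
    rw [mul_vecMulVec, mulVec_mulVec, mul_nonsing_inv _ hu, one_mulVec]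
  have e3 : vecMulVec x x * vecMulVec (V⁻¹ *ᵥ x) (V⁻¹ *ᵥ x) =
      (x ⬝ᵥ V⁻¹ *ᵥ x) • vecMulVec x (V⁻¹ *ᵥ x) := by
    rw [vecMulVec_mul_vecMulVec]
    ext i j
    simp [vecMulVec_apply]
    ring
  rw [add_mul, mul_sub, mul_sub, mul_nonsing_inv _ hu, mul_smul_comm, mul_smul_comm, e1, e2, e3]
  ext i j
  simp only [add_apply, sub_apply, smul_apply, smul_eq_mul]
  field_simp
  ring

/-- After expansion by Sherman-Morrison, the only loss is the discarded term `-(1 + u)⁻¹ s²`, with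
`u` the form at `x` and `s` the mixed term. This drives the recursion for the ridge error, `e` being
the noise of the new round. -/
theorem PosDef.quadForm_inv_add_vecMulVec_self {V : Matrix n n ℝ} (hV : V.PosDef)
    (x r : n → ℝ) (e : ℝ) :
    (r - e • x) ⬝ᵥ (V + vecMulVec x x)⁻¹ *ᵥ (r - e • x) ≤
      r ⬝ᵥ V⁻¹ *ᵥ r - 2 * ((1 + x ⬝ᵥ V⁻¹ *ᵥ x)⁻¹ * (r ⬝ᵥ V⁻¹ *ᵥ x)) * e
        + (1 + x ⬝ᵥ V⁻¹ *ᵥ x)⁻¹ * (x ⬝ᵥ V⁻¹ *ᵥ x) * e ^ 2 := by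
  have hpos : 0 < 1 + x ⬝ᵥ V⁻¹ *ᵥ x := by
    have := hV.quadForm_inv_nonneg x
    linarith
  have hvm : ∀ y : n → ℝ, vecMulVec (V⁻¹ *ᵥ x) (V⁻¹ *ᵥ x) *ᵥ y
      = (y ⬝ᵥ V⁻¹ *ᵥ x) • V⁻¹ *ᵥ x := by
    intro y
    ext i
    simp [vecMulVec_mulVec, dotProduct_comm, mul_comm]
  rw [hV.inv_add_vecMulVec_self, sub_mulVec, smul_mulVec, hvm]
  simp only [mulVec_sub, mulVec_smul, dotProduct_sub, sub_dotProduct, dotProduct_smul,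
    smul_dotProduct, smul_eq_mul, hV.dotProduct_inv_mulVec_comm x r]
  set u := x ⬝ᵥ V⁻¹ *ᵥ x
  set s := r ⬝ᵥ V⁻¹ *ᵥ x
  set q := r ⬝ᵥ V⁻¹ *ᵥ r
  have h : q - 2 * ((1 + u)⁻¹ * s) * e + (1 + u)⁻¹ * u * e ^ 2 - (1 + u)⁻¹ * s ^ 2
      = q - e * s - e * (s - e * u) - (1 + u)⁻¹ * ((s - e * u) * (s - e * u)) := by
    field_simp
    ring
  have h2 : 0 ≤ (1 + u)⁻¹ * s ^ 2 := by positivity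
  linarith

/-- Each eigenvalue is at most the sum of all. This is cruder than AM-GM, but only the logarithm
matters. -/
theorem PosDef.det_le_trace_pow {V : Matrix n n ℝ} (hV : V.PosDef) :
    V.det ≤ V.trace ^ Fintype.card n := by
  rw [hV.isHermitian.det_eq_prod_eigenvalues, hV.isHermitian.trace_eq_sum_eigenvalues,
    ← Finset.card_univ, ← Finset.prod_const]
  simp only [RCLike.ofReal_real_eq_id, id]
  exact Finset.prod_le_prod (fun i _ => (hV.eigenvalues_pos i).le)
    fun i _ => Finset.single_le_sum (fun j _ => (hV.eigenvalues_pos j).le) (Finset.mem_univ i)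

/-- If `V ≥ 1` then `V⁻¹ ≤ 1`. -/
theorem PosDef.quadForm_inv_le {V : Matrix n n ℝ} (hV : V.PosDef)
    (h1 : ∀ y : n → ℝ, y ⬝ᵥ y ≤ y ⬝ᵥ V *ᵥ y) (x : n → ℝ) : x ⬝ᵥ V⁻¹ *ᵥ x ≤ x ⬝ᵥ x := by
  have hu : IsUnit V.det := isUnit_iff_ne_zero.2 hV.det_pos.ne'
  -- At `y = V⁻¹ x` the hypothesis reads `|V⁻¹ x|² ≤ x ⬝ V⁻¹ x`; combine it with `|x - V⁻¹ x|² ≥ 0`.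
  have h2 := h1 (V⁻¹ *ᵥ x)
  rw [mulVec_mulVec, mul_nonsing_inv _ hu, one_mulVec] at h2
  have h3 : 0 ≤ (x - V⁻¹ *ᵥ x) ⬝ᵥ (x - V⁻¹ *ᵥ x) :=
    Finset.sum_nonneg fun i _ => mul_self_nonneg _
  simp only [dotProduct_sub, sub_dotProduct] at h3
  rw [dotProduct_comm (V⁻¹ *ᵥ x) x] at h2 h3
  linarith

end Matrix

/-! ### Ridge regression error and widths for a fixed history -/

namespace FairX

variable {d K : ℕ}

/-- The coordinates of the context of the arm chosen in a round. -/
def chosenContext (r : Round d K) : Fin d → ℝ := (r.1 r.2.2.1).ofLp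

/-- The regularized Gram matrix of the contexts chosen so far. -/
def gram {t : ℕ} (h : History d K t) : Matrix (Fin d) (Fin d) ℝ :=
  1 + ∑ s, Matrix.vecMulVec (chosenContext (h s)) (chosenContext (h s))

/-- `V θ - b`, where `V` is the Gram matrix and `b` the reward-weighted sum of chosen contexts, so
that `V⁻¹ b` is the ridge regression estimate. -/
def ridgeResidual {t : ℕ} (h : History d K t) (θ : Param d) : Fin d → ℝ :=
  Matrix.mulVec (gram h) θ.ofLp - ∑ s, (h s).2.2.2 • chosenContext (h s)

/-- The squared error of the ridge regression estimate in the norm of the Gram matrix. -/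
noncomputable def ridgeError {t : ℕ} (h : History d K t) (θ : Param d) : ℝ :=
  ridgeResidual h θ ⬝ᵥ Matrix.mulVec (gram h)⁻¹ (ridgeResidual h θ)

/-- The squared norm of a context for the inverse of the Gram matrix. -/
noncomputable def width {t : ℕ} (h : History d K t) (x : Param d) : ℝ :=
  x.ofLp ⬝ᵥ Matrix.mulVec (gram h)⁻¹ x.ofLp

/-- The inner product of the ridge residual and a context for the inverse of the Gram matrix. -/
noncomputable def correlation {t : ℕ} (h : History d K t) (θ x : Param d) : ℝ :=
  ridgeResidual h θ ⬝ᵥ Matrix.mulVec (gram h)⁻¹ x.ofLp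

section Deterministic

variable {t : ℕ} (h : History d K t)

theorem posDef_gram : (gram h).PosDef := by
  refine Matrix.PosDef.one.add_posSemidef (Matrix.posSemidef_sum _ fun s _ => ?_)
  simpa using Matrix.posSemidef_vecMulVec_self_star (chosenContext (h s))

theorem dotProduct_le_gram (y : Fin d → ℝ) : y ⬝ᵥ y ≤ y ⬝ᵥ Matrix.mulVec (gram h) y := by
  have h1 : (∑ s, Matrix.vecMulVec (chosenContext (h s)) (chosenContext (h s))).PosSemidef :=
    Matrix.posSemidef_sum _ fun s _ => by
      simpa using Matrix.posSemidef_vecMulVec_self_star (chosenContext (h s))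
  have h2 := h1.dotProduct_mulVec_nonneg y
  rw [gram, Matrix.add_mulVec, Matrix.one_mulVec, dotProduct_add]
  simpa using h2

theorem ridgeError_nonneg (θ : Param d) : 0 ≤ ridgeError h θ :=
  (posDef_gram h).quadForm_inv_nonneg _

theorem width_nonneg (x : Param d) : 0 ≤ width h x :=
  (posDef_gram h).quadForm_inv_nonneg _

theorem abs_correlation_le (θ x : Param d) {l : ℝ} (hl : 0 < l) :
    |correlation h θ x| ≤ (l * ridgeError h θ + l⁻¹ * width h x) / 2 :=
  (posDef_gram h).abs_dotProduct_inv_mulVec_le _ _ hl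

theorem width_le_norm_sq (x : Param d) : width h x ≤ ‖x‖ ^ 2 := by
  refine ((posDef_gram h).quadForm_inv_le (dotProduct_le_gram h) _).trans_eq ?_
  rw [EuclideanSpace.real_norm_sq_eq]
  simp [dotProduct, sq]

theorem inner_eq_dotProduct (x y : Param d) : ⟪x, y⟫ = x.ofLp ⬝ᵥ y.ofLp := by
  rw [EuclideanSpace.inner_eq_star_dotProduct, dotProduct_comm]
  simp

/-- Two parameters with small ridge regression error predict similar rewards. -/
theorem abs_inner_sub_inner_le (θ σ x : Param d) {l : ℝ} (hl : 0 < l) :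
    |⟪σ, x⟫ - ⟪θ, x⟫| ≤ l * (ridgeError h σ + ridgeError h θ) / 2 + l⁻¹ * width h x := by
  have hu : IsUnit (gram h).det := isUnit_iff_ne_zero.2 (posDef_gram h).det_pos.ne'
  have key : ∀ z : Param d, Matrix.mulVec (gram h) z.ofLp ⬝ᵥ Matrix.mulVec (gram h)⁻¹ x.ofLp
      = ⟪z, x⟫ := by
    intro z
    rw [Matrix.PosDef.dotProduct_inv_mulVec_comm (posDef_gram h), Matrix.mulVec_mulVec,
      Matrix.nonsing_inv_mul _ hu, Matrix.one_mulVec, inner_eq_dotProduct, dotProduct_comm]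
  -- The reward-weighted sum of contexts is common to both residuals and cancels.
  have e : ⟪σ, x⟫ - ⟪θ, x⟫ = correlation h σ x - correlation h θ x := by
    rw [← key σ, ← key θ]
    simp only [correlation, ridgeResidual, sub_dotProduct]
    ring
  have h1 := abs_correlation_le h σ x hl
  have h2 := abs_correlation_le h θ x hl
  have h3 := abs_sub (correlation h σ x) (correlation h θ x)
  rw [e]
  linarith

theorem trace_gram_le (hx : ∀ s, ‖(h s).1 (h s).2.2.1‖ ≤ 1) : (gram h).trace ≤ d + t := by
  rw [gram, Matrix.trace_add, Matrix.trace_sum, Matrix.trace_one, Fintype.card_fin]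
  gcongr
  calc ∑ s, (Matrix.vecMulVec (chosenContext (h s)) (chosenContext (h s))).trace
      ≤ ∑ _s : Fin t, (1 : ℝ) := by
        refine Finset.sum_le_sum fun s _ => ?_
        rw [Matrix.trace_vecMulVec, chosenContext, ← inner_eq_dotProduct,
          real_inner_self_eq_norm_sq]
        exact pow_le_one₀ (norm_nonneg _) (hx s)
    _ = t := by simp

theorem log_det_gram_le (hx : ∀ s, ‖(h s).1 (h s).2.2.1‖ ≤ 1) :
    Real.log (gram h).det ≤ d * Real.log (d + t) := by
  have h1 : (gram h).det ≤ (d + t : ℝ) ^ d := by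
    refine (posDef_gram h).det_le_trace_pow.trans ?_
    rw [Fintype.card_fin]
    exact pow_le_pow_left₀ (posDef_gram h).posSemidef.trace_nonneg (trace_gram_le h hx) d
  rw [← Real.log_pow]
  exact Real.log_le_log (posDef_gram h).det_pos h1

end Deterministic

/-! ### Measurability -/

theorem _root_.Measurable.context_arm {α : Type*} [MeasurableSpace α] {x : α → Contexts d K}
    {a : α → Fin K} (hx : Measurable x) (ha : Measurable a) : Measurable fun p => x p (a p) :=
  (measurable_from_prod_countable_left fun b => measurable_pi_apply b :
    Measurable fun p : Contexts d K × Fin K => p.1 p.2).comp (hx.prodMk ha)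

theorem measurable_chosenContext : Measurable (chosenContext : Round d K → Fin d → ℝ) := by
  have h : Measurable (fun r : Round d K => r.1 r.2.2.1) :=
    measurable_fst.context_arm (by fun_prop)
  exact (WithLp.measurable_ofLp 2 _).comp h

theorem measurable_gram_apply {t : ℕ} (i j : Fin d) :
    Measurable fun h : History d K t => gram h i j := by
  have hm : ∀ (s : Fin t) (k : Fin d), Measurable fun h : History d K t =>
      chosenContext (h s) k := fun s k =>
    (measurable_pi_apply k).comp (measurable_chosenContext.comp (measurable_pi_apply s))
  simp only [gram, Matrix.add_apply, Matrix.sum_apply, Matrix.vecMulVec_apply]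
  exact measurable_const.add
    (Finset.measurable_sum _ fun s _ => (hm s i).mul (hm s j))

theorem measurable_det {α n : Type*} [MeasurableSpace α] [Fintype n] [DecidableEq n]
    {M : α → Matrix n n ℝ} (hM : ∀ i j, Measurable fun a => M a i j) :
    Measurable fun a => (M a).det := by
  simp only [Matrix.det_apply]
  exact Finset.measurable_sum _ fun σ _ =>
    (Finset.measurable_prod _ fun i _ => hM (σ i) i).const_smul _

/-- By the adjugate formula the entries are quotients of polynomials. Singular matrices cause no
trouble, since division by zero is measurable as well. -/
theorem measurable_inv_apply {α n : Type*} [MeasurableSpace α] [Fintype n] [DecidableEq n]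
    {M : α → Matrix n n ℝ} (hM : ∀ i j, Measurable fun a => M a i j) (i j : n) :
    Measurable fun a => (M a)⁻¹ i j := by
  simp only [Matrix.inv_def, Ring.inverse_eq_inv', Matrix.smul_apply, smul_eq_mul,
    Matrix.adjugate_apply]
  refine (measurable_det hM).inv.mul (measurable_det fun k l => ?_)
  by_cases hk : k = j
  · simp [Matrix.updateRow_apply, hk]
  · simpa [Matrix.updateRow_apply, hk] using hM k l

section Measurability

variable {α : Type*} [MeasurableSpace α] {t : ℕ} {H : α → History d K t} {θ : α → Param d}
  {x : α → Contexts d K}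

theorem measurable_ridgeResidual_apply (hH : Measurable H) (hθ : Measurable θ) (i : Fin d) :
    Measurable fun p => ridgeResidual (H p) (θ p) i := by
  have hm : ∀ (s : Fin t) (k : Fin d), Measurable fun p => chosenContext (H p s) k := fun s k =>
    (measurable_pi_apply k).comp (measurable_chosenContext.comp ((measurable_pi_apply s).comp hH))
  have hr : ∀ s : Fin t, Measurable fun p => (H p s).2.2.2 := by
    intro s
    fun_prop
  simp only [ridgeResidual, Pi.sub_apply, Matrix.mulVec, dotProduct, Finset.sum_apply,
    Pi.smul_apply, smul_eq_mul]
  refine (Finset.measurable_sum _ fun j _ => ?_).sub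
    (Finset.measurable_sum _ fun s _ => (hr s).mul (hm s i))
  exact ((measurable_gram_apply i j).comp hH).mul (by fun_prop)

theorem measurable_inv_form {u v : α → Fin d → ℝ} (hH : Measurable H)
    (hu : ∀ i, Measurable fun a => u a i) (hv : ∀ i, Measurable fun a => v a i) :
    Measurable fun a => u a ⬝ᵥ Matrix.mulVec (gram (H a))⁻¹ (v a) := by
  simp only [Matrix.mulVec, dotProduct]
  exact Finset.measurable_sum _ fun i _ => (hu i).mul <| Finset.measurable_sum _ fun j _ =>
    (measurable_inv_apply (fun k l => (measurable_gram_apply k l).comp hH) i j).mul (hv j)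

theorem measurable_ridgeError (hH : Measurable H) (hθ : Measurable θ) :
    Measurable fun p => ridgeError (H p) (θ p) :=
  measurable_inv_form hH (measurable_ridgeResidual_apply hH hθ)
    (measurable_ridgeResidual_apply hH hθ)

theorem measurable_width (hH : Measurable H) (hθ : Measurable θ) :
    Measurable fun p => width (H p) (θ p) :=
  measurable_inv_form hH (fun i => by fun_prop) (fun i => by fun_prop)

theorem measurable_correlation (hH : Measurable H) (hθ : Measurable θ) {y : α → Param d}
    (hy : Measurable y) : Measurable fun p => correlation (H p) (θ p) (y p) :=
  measurable_inv_form hH (measurable_ridgeResidual_apply hH hθ) (fun i => by fun_prop)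

theorem measurable_fairPolicy {f : ℝ → ℝ} (hf : Measurable f) (hθ : Measurable θ)
    (hx : Measurable x) (a : Fin K) : Measurable fun p => fairPolicy f (θ p) (x p) a := by
  have h : ∀ b : Fin K, Measurable fun p => f ⟪θ p, x p b⟫ :=
    fun b => hf.comp (by fun_prop)
  exact (h a).div (Finset.measurable_sum _ fun b _ => h b)

end Measurability

/-! ### Averages under a fair policy -/

theorem fairPolicy_nonneg {f : ℝ → ℝ} (hf : ∀ y, 0 < f y) (θ : Param d) (x : Contexts d K)
    (a : Fin K) : 0 ≤ fairPolicy f θ x a :=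
  div_nonneg (hf _).le (Finset.sum_nonneg fun _ _ => (hf _).le)

/-- The inequality, unlike equality, also covers `K = 0`, and it suffices for all averages below. -/
theorem sum_fairPolicy_le_one (f : ℝ → ℝ) (θ : Param d) (x : Contexts d K) :
    ∑ a, fairPolicy f θ x a ≤ 1 := by
  simp only [fairPolicy]
  rw [← Finset.sum_div]
  exact div_self_le_one _

theorem abs_sum_fairPolicy_mul_le {f : ℝ → ℝ} (hf : ∀ y, 0 < f y) (θ : Param d)
    (x : Contexts d K) {g : Fin K → ℝ} {c : ℝ} (hc : 0 ≤ c) (hg : ∀ a, |g a| ≤ c) :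
    |∑ a, fairPolicy f θ x a * g a| ≤ c := by
  calc |∑ a, fairPolicy f θ x a * g a| ≤ ∑ a, |fairPolicy f θ x a * g a| :=
        Finset.abs_sum_le_sum_abs _ _
    _ ≤ ∑ a, fairPolicy f θ x a * c := by
        refine Finset.sum_le_sum fun a _ => ?_
        rw [abs_mul, abs_of_nonneg (fairPolicy_nonneg hf θ x a)]
        exact mul_le_mul_of_nonneg_left (hg a) (fairPolicy_nonneg hf θ x a)
    _ = (∑ a, fairPolicy f θ x a) * c := by rw [Finset.sum_mul]
    _ ≤ c := mul_le_of_le_one_left hc (sum_fairPolicy_le_one f θ x)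

theorem abs_sum_fairPolicy_mul_inner_sub_le {f : ℝ → ℝ} (hf : ∀ y, 0 < f y) {t : ℕ}
    (h : History d K t) (θ σ : Param d) (x : Contexts d K) {l : ℝ} (hl : 0 < l) :
    |∑ a, fairPolicy f σ x a * ⟪σ, x a⟫ - ∑ a, fairPolicy f σ x a * ⟪θ, x a⟫| ≤
      l / 2 * (ridgeError h σ + ridgeError h θ)
        + l⁻¹ * ∑ a, fairPolicy f σ x a * width h (x a) := by
  have hp := fairPolicy_nonneg hf σ x
  have h0 : 0 ≤ l / 2 * (ridgeError h σ + ridgeError h θ) :=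
    mul_nonneg (by linarith) (add_nonneg (ridgeError_nonneg _ _) (ridgeError_nonneg _ _))
  rw [← Finset.sum_sub_distrib]
  calc |∑ a, (fairPolicy f σ x a * ⟪σ, x a⟫ - fairPolicy f σ x a * ⟪θ, x a⟫)|
      ≤ ∑ a, |fairPolicy f σ x a * ⟪σ, x a⟫ - fairPolicy f σ x a * ⟪θ, x a⟫| :=
        Finset.abs_sum_le_sum_abs _ _
    _ ≤ ∑ a, fairPolicy f σ x a * (l / 2 * (ridgeError h σ + ridgeError h θ)
          + l⁻¹ * width h (x a)) := by
        refine Finset.sum_le_sum fun a _ => ?_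
        rw [← mul_sub, abs_mul, abs_of_nonneg (hp a)]
        refine mul_le_mul_of_nonneg_left ?_ (hp a)
        exact (abs_inner_sub_inner_le h _ _ _ hl).trans_eq (by ring)
    _ = (∑ a, fairPolicy f σ x a) * (l / 2 * (ridgeError h σ + ridgeError h θ))
          + l⁻¹ * ∑ a, fairPolicy f σ x a * width h (x a) := by
        rw [Finset.sum_mul, Finset.mul_sum, ← Finset.sum_add_distrib]
        exact Finset.sum_congr rfl fun a _ => by ring
    _ ≤ _ := add_le_add_left (mul_le_of_le_one_left h0 (sum_fairPolicy_le_one f σ x)) _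

/-! ### Pathwise evolution of the Gram matrix and the ridge error -/

namespace Run

variable {Ω : Type*} (f : ℝ → ℝ) (R : Run d K Ω)

/-- The context of the arm played in round `t`. -/
def playedContext (t : ℕ) (ω : Ω) : Param d := R.context t ω (R.arm t ω)

theorem chosenContext_history (t : ℕ) (ω : Ω) (s : Fin t) :
    chosenContext (R.history f t ω s) = (R.playedContext s ω).ofLp := rfl

theorem gram_history_succ (t : ℕ) (ω : Ω) :
    gram (R.history f (t + 1) ω) = gram (R.history f t ω) +
      Matrix.vecMulVec (R.playedContext t ω).ofLp (R.playedContext t ω).ofLp := by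
  simp only [gram, chosenContext_history, Fin.sum_univ_castSucc, add_assoc, Fin.val_castSucc,
    Fin.val_last]

/-- A round adds `(x ⬝ θ) x` to `V θ` and `r x` to the reward-weighted sum; at the true parameter
the difference is minus the noise times `x`. -/
theorem ridgeResidual_history_succ (t : ℕ) (ω : Ω) :
    ridgeResidual (R.history f (t + 1) ω) (R.trueParam ω) =
      ridgeResidual (R.history f t ω) (R.trueParam ω)
        - R.noise t ω • (R.playedContext t ω).ofLp := by
  have hr : ∀ (n : ℕ) (s : Fin n), (R.history f n ω s).2.2.2 = R.reward s ω := fun _ _ => rfl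
  have hx : ⟪R.trueParam ω, R.playedContext t ω⟫ =
      (R.playedContext t ω).ofLp ⬝ᵥ (R.trueParam ω).ofLp := by
    rw [inner_eq_dotProduct, dotProduct_comm]
  have hn : R.noise t ω = R.reward t ω - ⟪R.trueParam ω, R.playedContext t ω⟫ := rfl
  rw [hn, hx, ridgeResidual, ridgeResidual, gram_history_succ]
  simp only [chosenContext_history, Fin.sum_univ_castSucc, Fin.val_castSucc, hr,
    Fin.val_last, Matrix.add_mulVec, Matrix.vecMulVec_mulVec]
  ext i
  simp
  ring

theorem ridgeError_history_zero (ω : Ω) :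
    ridgeError (R.history f 0 ω) (R.trueParam ω) = ‖R.trueParam ω‖ ^ 2 := by
  rw [EuclideanSpace.real_norm_sq_eq]
  simp [ridgeError, ridgeResidual, gram, dotProduct, sq]

theorem ridgeError_history_succ_le (t : ℕ) (ω : Ω) :
    ridgeError (R.history f (t + 1) ω) (R.trueParam ω) ≤
      ridgeError (R.history f t ω) (R.trueParam ω)
      - 2 * ((1 + width (R.history f t ω) (R.playedContext t ω))⁻¹ *
          correlation (R.history f t ω) (R.trueParam ω) (R.playedContext t ω)) * R.noise t ω
      + (1 + width (R.history f t ω) (R.playedContext t ω))⁻¹ *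
          width (R.history f t ω) (R.playedContext t ω) * R.noise t ω ^ 2 := by
  have h := (posDef_gram (R.history f t ω)).quadForm_inv_add_vecMulVec_self
    (R.playedContext t ω).ofLp (ridgeResidual (R.history f t ω) (R.trueParam ω)) (R.noise t ω)
  rw [ridgeError, gram_history_succ, ridgeResidual_history_succ]
  exact h

/-- The elliptical potential lemma: the log-determinant telescopes. -/
theorem sum_log_one_add_width (T : ℕ) (ω : Ω) :
    ∑ t ∈ Finset.range T, Real.log (1 + width (R.history f t ω) (R.playedContext t ω)) =
      Real.log (gram (R.history f T ω)).det := by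
  induction T with
  | zero => simp [gram]
  | succ t ih =>
    have h1 := width_nonneg (R.history f t ω) (R.playedContext t ω)
    rw [Finset.sum_range_succ, ih, gram_history_succ,
      (posDef_gram (R.history f t ω)).det_add_vecMulVec_self,
      Real.log_mul (posDef_gram _).det_pos.ne' (by unfold width at h1; linarith)]
    rfl

theorem sum_width_le (T : ℕ) (ω : Ω) (hx : ∀ t, ‖R.playedContext t ω‖ ≤ 1) :
    ∑ t ∈ Finset.range T, width (R.history f t ω) (R.playedContext t ω) ≤
      2 * (d * Real.log (d + T)) := by
  calc ∑ t ∈ Finset.range T, width (R.history f t ω) (R.playedContext t ω)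
      ≤ ∑ t ∈ Finset.range T,
          2 * Real.log (1 + width (R.history f t ω) (R.playedContext t ω)) := by
        refine Finset.sum_le_sum fun t _ => ?_
        have h0 := width_nonneg (R.history f t ω) (R.playedContext t ω)
        have h1 := (width_le_norm_sq (R.history f t ω) (R.playedContext t ω)).trans
          (pow_le_one₀ (norm_nonneg _) (hx t))
        set u := width (R.history f t ω) (R.playedContext t ω)
        -- For `0 ≤ u ≤ 1`, `log (1 + u) ≥ u / (1 + u) ≥ u / 2`; this is the source of the factor
        -- `2`.
        have h2 := Real.one_sub_inv_le_log_of_pos (by linarith : 0 < 1 + u)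
        have h3 : u / 2 ≤ 1 - (1 + u)⁻¹ := by
          rw [show 1 - (1 + u)⁻¹ = u / (1 + u) by field_simp; ring]
          exact div_le_div_of_nonneg_left h0 (by linarith) (by linarith)
        linarith
    _ = 2 * Real.log (gram (R.history f T ω)).det := by
        rw [← Finset.mul_sum, sum_log_one_add_width]
    _ ≤ _ := by
        gcongr
        exact log_det_gram_le _ fun s => hx s

end Run

end FairX

/-! ### Conditional laws and Gaussian second moments -/

namespace ProbabilityTheory

theorem HasCondDistrib.lintegral_comp_prodMk {Ω 𝓧 𝓨 : Type*} {mΩ : MeasurableSpace Ω}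
    {m𝓧 : MeasurableSpace 𝓧} {m𝓨 : MeasurableSpace 𝓨} {P : Measure Ω} [IsFiniteMeasure P]
    {X : Ω → 𝓧} {Y : Ω → 𝓨} {κ : Kernel 𝓧 𝓨} [IsSFiniteKernel κ] (h : HasCondDistrib Y X κ P)
    {F : 𝓧 × 𝓨 → ℝ≥0∞} (hF : Measurable F) :
    ∫⁻ ω, F (X ω, Y ω) ∂P = ∫⁻ ω, ∫⁻ y, F (X ω, y) ∂κ (X ω) ∂P := by
  have h1 := HasLaw.lintegral_comp h (f := F) hF.aemeasurable
  rw [h1, Measure.lintegral_compProd hF,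
    lintegral_map' (hF.lintegral_kernel_prod_right').aemeasurable h.aemeasurable_fst]

theorem hasCondDistrib_condDistrib {Ω 𝓧 𝓨 : Type*} {mΩ : MeasurableSpace Ω}
    {m𝓧 : MeasurableSpace 𝓧} {m𝓨 : MeasurableSpace 𝓨} [StandardBorelSpace 𝓨] [Nonempty 𝓨]
    {P : Measure Ω} [IsFiniteMeasure P] {X : Ω → 𝓧} {Y : Ω → 𝓨} (hX : AEMeasurable X P)
    (hY : AEMeasurable Y P) : HasCondDistrib Y X (condDistrib Y X P) P :=
  ⟨hX.prodMk hY, (compProd_map_condDistrib hY).symm⟩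

theorem memLp_id_stdGaussian {d : ℕ} :
    MemLp id 2 (stdGaussian (EuclideanSpace ℝ (Fin d))) := IsGaussian.memLp_two_id

theorem integral_norm_sq_stdGaussian (d : ℕ) :
    ∫ x, ‖x‖ ^ 2 ∂(stdGaussian (EuclideanSpace ℝ (Fin d))) = d := by
  have hL : ∀ i : Fin d, MemLp (fun x : EuclideanSpace ℝ (Fin d) => x i) 2
      (stdGaussian (EuclideanSpace ℝ (Fin d))) := fun i =>
    (EuclideanSpace.proj (𝕜 := ℝ) i : EuclideanSpace ℝ (Fin d) →L[ℝ] ℝ).comp_memLp' memLp_id_stdGaussian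
  have h1 : ∀ i : Fin d, ∫ x, x i ^ 2 ∂(stdGaussian (EuclideanSpace ℝ (Fin d))) = 1 := by
    intro i
    -- A coordinate is the functional dual to a unit vector, so its variance is the squared norm
    -- `1`.
    have h2 := variance_dual_stdGaussian (innerSL ℝ (EuclideanSpace.single i (1 : ℝ)))
    have h3 : ⇑(innerSL ℝ (EuclideanSpace.single i (1 : ℝ))) =
        fun x : EuclideanSpace ℝ (Fin d) => x i := by
      ext x
      simp [EuclideanSpace.inner_single_left]
    rw [variance_of_integral_eq_zero (by fun_prop) (integral_strongDual_stdGaussian _), h3] at h2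
    rw [h2, innerSL_apply_norm]
    simp
  simp only [EuclideanSpace.real_norm_sq_eq]
  rw [integral_finsetSum _ fun i _ => (hL i).integrable_sq]
  simp [h1]

end ProbabilityTheory

/-! ### Posterior matching and the law of the played arm -/

namespace FairX.Run

variable {d K : ℕ} {Ω : Type*} [MeasurableSpace Ω] {P : Measure Ω} [IsProbabilityMeasure P]
  {f : ℝ → ℝ} {env : (t : ℕ) → Kernel (History d K t) (Contexts d K)} {R : Run d K Ω}

namespace IsFairXLinTS

theorem measurable_policy (hR : R.IsFairXLinTS P f env) (hf : Measurable f) (t : ℕ) :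
    Measurable (R.policy f t) :=
  measurable_pi_lambda _ fun a =>
    measurable_fairPolicy hf (hR.measurable_sample t) (hR.measurable_context t) a

theorem measurable_history (hR : R.IsFairXLinTS P f env) (hf : Measurable f) (t : ℕ) :
    Measurable (R.history f t) :=
  measurable_pi_lambda _ fun s => (hR.measurable_context s).prodMk <|
    (hR.measurable_policy hf s).prodMk <| (hR.measurable_arm s).prodMk (hR.measurable_reward s)

theorem measurable_playedContext (hR : R.IsFairXLinTS P f env) (t : ℕ) :
    Measurable (R.playedContext t) :=
  (hR.measurable_context t).context_arm (hR.measurable_arm t)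

theorem measurable_noise (hR : R.IsFairXLinTS P f env) (t : ℕ) : Measurable (R.noise t) := by
  have h1 := hR.measurable_playedContext t
  have h2 := hR.measurable_trueParam
  have h3 := hR.measurable_reward t
  have h4 : Measurable fun ω => ⟪R.trueParam ω, R.playedContext t ω⟫ := h2.inner h1
  exact h3.sub h4

theorem memLp_trueParam (hR : R.IsFairXLinTS P f env) : MemLp R.trueParam 2 P := by
  have h := memLp_id_stdGaussian (d := d)
  rw [← hR.trueParam_law.map_eq, memLp_map_measure_iff aestronglyMeasurable_id
    hR.measurable_trueParam.aemeasurable] at h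
  exact h

theorem integral_norm_trueParam_sq (hR : R.IsFairXLinTS P f env) :
    ∫ ω, ‖R.trueParam ω‖ ^ 2 ∂P = d := by
  rw [← integral_norm_sq_stdGaussian d]
  exact hR.trueParam_law.integral_comp (f := fun x => ‖x‖ ^ 2)
    (by fun_prop : Continuous fun x : Param d => ‖x‖ ^ 2).aestronglyMeasurable

theorem memLp_noise (hR : R.IsFairXLinTS P f env) (t : ℕ) : MemLp (R.noise t) 2 P := by
  have h : MemLp id 2 (gaussianReal 0 1) := memLp_id_gaussianReal 2
  rw [← (hR.noise_law t).map_eq, memLp_map_measure_iff aestronglyMeasurable_id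
    (hR.measurable_noise t).aemeasurable] at h
  exact h

theorem integral_noise (hR : R.IsFairXLinTS P f env) (t : ℕ) : ∫ ω, R.noise t ω ∂P = 0 := by
  rw [(hR.noise_law t).integral_eq]
  exact integral_id_gaussianReal

theorem integral_noise_sq (hR : R.IsFairXLinTS P f env) (t : ℕ) :
    ∫ ω, R.noise t ω ^ 2 ∂P = 1 := by
  have h1 := (hR.noise_law t).variance_eq
  rw [variance_id_gaussianReal, variance_of_integral_eq_zero (hR.measurable_noise t).aemeasurable
    (hR.integral_noise t)] at h1
  simpa using h1

/-- Posterior matching: the sampled and the true parameter have the same joint law with the history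
and the current contexts. -/
theorem identDistrib_sample_trueParam (hR : R.IsFairXLinTS P f env) (hf : Measurable f)
    [∀ t, IsMarkovKernel (env t)] (t : ℕ) :
    IdentDistrib (fun ω => (R.sample t ω, R.history f t ω, R.context t ω))
      (fun ω => (R.trueParam ω, R.history f t ω, R.context t ω)) P P := by
  have hH := hR.measurable_history hf t
  have hθ := hR.measurable_trueParam
  have hx := hR.measurable_context t
  have hσ := hR.measurable_sample t
  refine ⟨by fun_prop, by fun_prop, ?_⟩
  refine Measure.ext_of_lintegral _ fun F hF => ?_
  rw [lintegral_map hF (by fun_prop), lintegral_map hF (by fun_prop)]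
  have hκ : HasCondDistrib R.trueParam (R.history f t) (R.posteriorKernel P f t) P :=
    hasCondDistrib_condDistrib hH.aemeasurable hθ.aemeasurable
  have hs := hR.sample_law t
  have : IsMarkovKernel (R.posteriorKernel P f t) := by
    unfold posteriorKernel
    infer_instance
  generalize R.posteriorKernel P f t = κ at this hκ hs
  -- Given the history, one side draws the contexts and then the parameter, the other the parameter
  -- and then the contexts. Neither kernel sees the other draw, so Tonelli identifies the two.
  have e1 : ∫⁻ ω, F (R.sample t ω, R.history f t ω, R.context t ω) ∂P =
      ∫⁻ ω, ∫⁻ σ, F (σ, R.history f t ω, R.context t ω) ∂κ (R.history f t ω) ∂P :=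
    hs.lintegral_comp_prodMk
      (F := fun p => F (p.2, p.1.2.1, p.1.2.2)) (hF.comp (by fun_prop))
  have e2 : ∫⁻ ω, ∫⁻ σ, F (σ, R.history f t ω, R.context t ω) ∂κ (R.history f t ω) ∂P =
      ∫⁻ ω, ∫⁻ x, ∫⁻ σ, F (σ, R.history f t ω, x)
        ∂κ (R.history f t ω) ∂env t (R.history f t ω) ∂P := by
    refine (hR.context_law t).lintegral_comp_prodMk (F := fun p => ∫⁻ σ, F (σ, p.1.2, p.2)
      ∂κ p.1.2) ?_
    exact Measurable.lintegral_kernel_prod_right'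
      (κ := (κ).comap
        (fun p : (Param d × History d K t) × Contexts d K => p.1.2) (by fun_prop))
      (f := fun q => F (q.2, q.1.1.2, q.1.2)) (hF.comp (by fun_prop))
  have e3 : ∫⁻ ω, F (R.trueParam ω, R.history f t ω, R.context t ω) ∂P =
      ∫⁻ ω, ∫⁻ x, F (R.trueParam ω, R.history f t ω, x) ∂env t (R.history f t ω) ∂P :=
    (hR.context_law t).lintegral_comp_prodMk
      (F := fun p => F (p.1.1, p.1.2, p.2)) (hF.comp (by fun_prop))
  have e4 : ∫⁻ ω, ∫⁻ x, F (R.trueParam ω, R.history f t ω, x) ∂env t (R.history f t ω) ∂P =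
      ∫⁻ ω, ∫⁻ σ, ∫⁻ x, F (σ, R.history f t ω, x)
        ∂env t (R.history f t ω) ∂κ (R.history f t ω) ∂P := by
    refine hκ.lintegral_comp_prodMk
      (F := fun p => ∫⁻ x, F (p.2, p.1, x) ∂env t p.1) ?_
    exact Measurable.lintegral_kernel_prod_right'
      (κ := (env t).comap (fun p : History d K t × Param d => p.1) (by fun_prop))
      (f := fun q => F (q.1.2, q.1.1, q.2)) (hF.comp (by fun_prop))
  rw [e1, e2, e3, e4]
  refine lintegral_congr fun ω => lintegral_lintegral_swap ?_
  exact (hF.comp (by fun_prop)).aemeasurable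

/-- The mean of a bounded function of the played arm is its mean under the deployed policy. -/
theorem integral_arm (hR : R.IsFairXLinTS P f env) (hf : Measurable f) (t : ℕ)
    {g : History d K t × Contexts d K → Fin K → ℝ} (hg : ∀ a, Measurable fun p => g p a)
    {c : ℝ} (hc : ∀ a, ∀ᵐ ω ∂P, |g (R.history f t ω, R.context t ω) a| ≤ c) :
    ∫ ω, ∑ a, R.policy f t ω a * g (R.history f t ω, R.context t ω) a ∂P =
      ∫ ω, g (R.history f t ω, R.context t ω) (R.arm t ω) ∂P := by
  have hH := hR.measurable_history hf t
  have hθ := hR.measurable_trueParam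
  have hx := hR.measurable_context t
  have hσ := hR.measurable_sample t
  have hA := hR.measurable_arm t
  set G : Ω → Param d × History d K t × Contexts d K × Param d :=
    fun ω => (R.trueParam ω, R.history f t ω, R.context t ω, R.sample t ω) with hG
  have hGm : Measurable G := by fun_prop
  have hm : MeasurableSpace.comap G inferInstance ≤ ‹MeasurableSpace Ω› := hGm.comap_le
  have hgm : ∀ a, Measurable fun ω => g (R.history f t ω, R.context t ω) a := fun a =>
    (hg a).comp (hH.prodMk hx)
  have hI : ∀ a, Integrable ((R.arm t ⁻¹' {a}).indicator fun _ => (1 : ℝ)) P := fun a =>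
    (integrable_const 1).indicator (hA (measurableSet_singleton a))
  -- The function `g` depends only on what precedes the arm, so it leaves the conditional
  -- expectation; the indicator of the arm becomes its policy weight.
  have key : ∀ a, P[(fun ω => g (R.history f t ω, R.context t ω) a) *
        (R.arm t ⁻¹' {a}).indicator (fun _ => (1 : ℝ)) | MeasurableSpace.comap G inferInstance]
      =ᵐ[P] fun ω => R.policy f t ω a * g (R.history f t ω, R.context t ω) a := by
    intro a
    have hs : StronglyMeasurable[MeasurableSpace.comap G inferInstance]
        fun ω => g (R.history f t ω, R.context t ω) a := by
      refine Measurable.stronglyMeasurable ?_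
      have : (fun ω => g (R.history f t ω, R.context t ω) a) =
          (fun q : Param d × History d K t × Contexts d K × Param d => g (q.2.1, q.2.2.1) a) ∘ G :=
        rfl
      rw [this]
      exact ((hg a).comp (by fun_prop)).comp (comap_measurable G)
    refine (condExp_stronglyMeasurable_mul_of_bound hm hs (hI a) c (hc a)).trans ?_
    filter_upwards [hR.arm_law t a] with ω hω
    rw [Pi.mul_apply, mul_comm]
    exact congrArg (· * _) hω
  have hprod : ∀ a, Integrable ((fun ω => g (R.history f t ω, R.context t ω) a) *
      (R.arm t ⁻¹' {a}).indicator (fun _ => (1 : ℝ))) P := fun a =>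
    (hI a).bdd_mul (hgm a).aestronglyMeasurable (hc a)
  have h2 : ∀ a, Integrable (fun ω =>
      R.policy f t ω a * g (R.history f t ω, R.context t ω) a) P := fun a =>
    integrable_condExp.congr (key a)
  rw [integral_finsetSum _ fun a _ => h2 a]
  have h3 : ∀ a, ∫ ω, R.policy f t ω a * g (R.history f t ω, R.context t ω) a ∂P =
      ∫ ω, g (R.history f t ω, R.context t ω) a *
        (R.arm t ⁻¹' {a}).indicator (fun _ => (1 : ℝ)) ω ∂P := by
    intro a
    rw [← integral_congr_ae (key a), integral_condExp hm]
    rfl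
  simp only [h3]
  refine (integral_finsetSum _ fun a _ => hprod a).symm.trans ?_
  refine integral_congr_ae (Filter.Eventually.of_forall fun ω => ?_)
  change ∑ a, g (R.history f t ω, R.context t ω) a *
    (R.arm t ⁻¹' {a}).indicator (fun _ => (1 : ℝ)) ω = _
  rw [Finset.sum_eq_single (R.arm t ω)]
  · simp
  · intro b _ hb
    simp [hb.symm]
  · simp

end IsFairXLinTS

end FairX.Run

/-! ### Growth of the expected ridge error -/

theorem integral_le_of_indepFun_noise {Ω : Type*} [MeasurableSpace Ω] {P : Measure Ω}
    [IsProbabilityMeasure P] {q q' s u e : Ω → ℝ} (hq : Integrable q P) (hu : Integrable u P)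
    (hu0 : ∀ ω, 0 ≤ u ω) (hum : Measurable u) (hsm : Measurable s)
    (hsb : ∀ ω, |s ω| ≤ (q ω + u ω) / 2) (hqm : Measurable q') (hq0 : ∀ ω, 0 ≤ q' ω)
    (he : MemLp e 2 P) (he0 : ∫ ω, e ω ∂P = 0) (hev : ∫ ω, e ω ^ 2 ∂P = 1)
    (hi1 : IndepFun (fun ω => (1 + u ω)⁻¹ * s ω) e P)
    (hi2 : IndepFun (fun ω => (1 + u ω)⁻¹ * u ω) (fun ω => e ω ^ 2) P)
    (hle : ∀ ω, q' ω ≤ q ω - 2 * ((1 + u ω)⁻¹ * s ω) * e ω + (1 + u ω)⁻¹ * u ω * e ω ^ 2) :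
    Integrable q' P ∧ ∫ ω, q' ω ∂P ≤ ∫ ω, q ω ∂P + ∫ ω, u ω ∂P := by
  have hη1 : Integrable e P := he.integrable (by norm_num)
  have hη2 : Integrable (fun ω => e ω ^ 2) P := he.integrable_sq
  simp only [mul_assoc (2 : ℝ)] at hle
  have hc1 : ∀ ω, (1 + u ω)⁻¹ ≤ 1 := fun ω => inv_le_one_of_one_le₀ (by linarith [hu0 ω])
  have hc0 : ∀ ω, 0 ≤ (1 + u ω)⁻¹ := fun ω => inv_nonneg.2 (by linarith [hu0 ω])
  -- No square integrability of `s` is needed: the Cauchy-Schwarz bound `hsb` dominates it by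
  -- integrable functions.
  have hcs : Integrable (fun ω => (1 + u ω)⁻¹ * s ω) P := by
    refine ((hq.add hu).div_const 2).mono'
      ((hum.const_add 1).inv.mul hsm).aestronglyMeasurable (Filter.Eventually.of_forall fun ω => ?_)
    rw [norm_mul, Real.norm_of_nonneg (hc0 ω), Real.norm_eq_abs]
    exact (mul_le_of_le_one_left (abs_nonneg _) (hc1 ω)).trans (hsb ω)
  have hcu_le : ∀ ω, (1 + u ω)⁻¹ * u ω ≤ u ω := fun ω => mul_le_of_le_one_left (hu0 ω) (hc1 ω)
  have hcu : Integrable (fun ω => (1 + u ω)⁻¹ * u ω) P := by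
    refine hu.mono' ((hum.const_add 1).inv.mul hum).aestronglyMeasurable
      (Filter.Eventually.of_forall fun ω => ?_)
    rw [Real.norm_of_nonneg (mul_nonneg (hc0 ω) (hu0 ω))]
    exact hcu_le ω
  have hm1 : Integrable (fun ω => (1 + u ω)⁻¹ * s ω * e ω) P := hi1.integrable_mul hcs hη1
  have hm2 : Integrable (fun ω => (1 + u ω)⁻¹ * u ω * e ω ^ 2) P :=
    hi2.integrable_mul hcu hη2
  -- The linear term vanishes by independence and centering; the quadratic one keeps its
  -- coefficient, since the noise has variance `1`.
  have he1 : ∫ ω, (1 + u ω)⁻¹ * s ω * e ω ∂P = 0 := by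
    rw [hi1.integral_fun_mul_eq_mul_integral hcs.aestronglyMeasurable hη1.aestronglyMeasurable,
      he0, mul_zero]
  have he2 : ∫ ω, (1 + u ω)⁻¹ * u ω * e ω ^ 2 ∂P = ∫ ω, (1 + u ω)⁻¹ * u ω ∂P := by
    rw [hi2.integral_fun_mul_eq_mul_integral hcu.aestronglyMeasurable hη2.aestronglyMeasurable,
      hev, mul_one]
  have hbi : Integrable (fun ω => q ω - 2 * ((1 + u ω)⁻¹ * s ω * e ω)
      + (1 + u ω)⁻¹ * u ω * e ω ^ 2) P := (hq.sub (hm1.const_mul 2)).add hm2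
  have hint : Integrable q' P := by
    refine hbi.mono' hqm.aestronglyMeasurable (Filter.Eventually.of_forall fun ω => ?_)
    rw [Real.norm_of_nonneg (hq0 ω)]
    exact hle ω
  refine ⟨hint, (integral_mono hint hbi hle).trans ?_⟩
  have hsub : Integrable (fun ω => q ω - 2 * ((1 + u ω)⁻¹ * s ω * e ω)) P :=
    hq.sub (hm1.const_mul 2)
  rw [integral_add hsub hm2, integral_sub hq (hm1.const_mul 2),
    integral_const_mul, he1, he2]
  have := integral_mono hcu hu hcu_le
  linarith

namespace FairX.Run

theorem ae_norm_context_le {d K : ℕ} {Ω : Type*} [MeasurableSpace Ω] {P : Measure Ω}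
    {R : Run d K Ω} (hx : ∀ t a, ∀ᵐ ω ∂P, ‖R.context t ω a‖ ≤ 1) :
    ∀ᵐ ω ∂P, ∀ t a, ‖R.context t ω a‖ ≤ 1 :=
  ae_all_iff.2 fun t => ae_all_iff.2 fun a => hx t a

variable {d K : ℕ} {Ω : Type*} [MeasurableSpace Ω] {P : Measure Ω} [IsProbabilityMeasure P]
  {f : ℝ → ℝ} {env : (t : ℕ) → Kernel (History d K t) (Contexts d K)} {R : Run d K Ω}

namespace IsFairXLinTS

theorem measurable_width_playedContext (hR : R.IsFairXLinTS P f env) (hf : Measurable f) (t : ℕ) :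
    Measurable fun ω => width (R.history f t ω) (R.playedContext t ω) :=
  measurable_width (hR.measurable_history hf t) (hR.measurable_playedContext t)

theorem integrable_width_playedContext (hR : R.IsFairXLinTS P f env) (hf : Measurable f)
    (hx : ∀ t a, ∀ᵐ ω ∂P, ‖R.context t ω a‖ ≤ 1) (t : ℕ) :
    Integrable (fun ω => width (R.history f t ω) (R.playedContext t ω)) P := by
  refine Integrable.of_bound (hR.measurable_width_playedContext hf t).aestronglyMeasurable 1 ?_
  filter_upwards [ae_norm_context_le hx] with ω hω
  rw [Real.norm_of_nonneg (width_nonneg _ _)]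
  exact (width_le_norm_sq _ _).trans (pow_le_one₀ (norm_nonneg _) (hω t _))

/-- Width and correlation at the played context are functions of this triple, so the noise is
independent of the coefficients in the ridge error recursion. -/
theorem indepFun_playedContext_noise (hR : R.IsFairXLinTS P f env) (t : ℕ) :
    IndepFun (fun ω => (R.trueParam ω, R.history f t ω, R.playedContext t ω)) (R.noise t) P := by
  have hm : Measurable fun p : Param d × History d K t × Contexts d K × Param d × Fin K =>
      (p.1, p.2.1, p.2.2.1 p.2.2.2.2) :=
    measurable_fst.prodMk ((measurable_fst.comp measurable_snd).prodMk
      (Measurable.context_arm (by fun_prop) (by fun_prop)))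
  exact (hR.noise_indep t).symm.comp hm measurable_id

theorem integral_ridgeError_succ_le (hR : R.IsFairXLinTS P f env) (hf : Measurable f)
    (hx : ∀ t a, ∀ᵐ ω ∂P, ‖R.context t ω a‖ ≤ 1) (t : ℕ)
    (hq : Integrable (fun ω => ridgeError (R.history f t ω) (R.trueParam ω)) P) :
    Integrable (fun ω => ridgeError (R.history f (t + 1) ω) (R.trueParam ω)) P ∧
      ∫ ω, ridgeError (R.history f (t + 1) ω) (R.trueParam ω) ∂P ≤
        ∫ ω, ridgeError (R.history f t ω) (R.trueParam ω) ∂P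
          + ∫ ω, width (R.history f t ω) (R.playedContext t ω) ∂P := by
  have hH := hR.measurable_history hf t
  have hθ := hR.measurable_trueParam
  have hX := hR.measurable_playedContext t
  have hindep := hR.indepFun_playedContext_noise t
  exact integral_le_of_indepFun_noise hq (hR.integrable_width_playedContext hf hx t)
    (fun ω => width_nonneg _ _) (measurable_width hH hX) (measurable_correlation hH hθ hX)
    (fun ω => by simpa using
      abs_correlation_le (R.history f t ω) (R.trueParam ω) (R.playedContext t ω) one_pos)
    (measurable_ridgeError (hR.measurable_history hf (t + 1)) hθ) (fun ω => ridgeError_nonneg _ _)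
    (hR.memLp_noise t) (hR.integral_noise t) (hR.integral_noise_sq t)
    (hindep.comp (((measurable_width (by fun_prop) (by fun_prop)).const_add 1).inv.mul
      (measurable_correlation (by fun_prop) (by fun_prop) (by fun_prop)) :
      Measurable fun p : Param d × History d K t × Param d =>
        (1 + width p.2.1 p.2.2)⁻¹ * correlation p.2.1 p.1 p.2.2) measurable_id)
    (hindep.comp (((measurable_width (by fun_prop) (by fun_prop)).const_add 1).inv.mul
      (measurable_width (by fun_prop) (by fun_prop)) :
      Measurable fun p : Param d × History d K t × Param d =>
        (1 + width p.2.1 p.2.2)⁻¹ * width p.2.1 p.2.2)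
      (by fun_prop : Measurable fun y : ℝ => y ^ 2))
    (R.ridgeError_history_succ_le f t)

theorem integral_ridgeError_le (hR : R.IsFairXLinTS P f env) (hf : Measurable f)
    (hx : ∀ t a, ∀ᵐ ω ∂P, ‖R.context t ω a‖ ≤ 1) (t : ℕ) :
    Integrable (fun ω => ridgeError (R.history f t ω) (R.trueParam ω)) P ∧
      ∫ ω, ridgeError (R.history f t ω) (R.trueParam ω) ∂P ≤
        d + ∑ s ∈ Finset.range t, ∫ ω, width (R.history f s ω) (R.playedContext s ω) ∂P := by
  induction t with
  | zero =>
    simp only [ridgeError_history_zero]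
    exact ⟨hR.memLp_trueParam.integrable_norm_pow (by norm_num), by
      simp [hR.integral_norm_trueParam_sq]⟩
  | succ t ih =>
    have h := hR.integral_ridgeError_succ_le hf hx t ih.1
    refine ⟨h.1, h.2.trans ?_⟩
    rw [Finset.sum_range_succ]
    linarith [ih.2]

theorem sum_integral_width_le (hR : R.IsFairXLinTS P f env) (hf : Measurable f)
    (hx : ∀ t a, ∀ᵐ ω ∂P, ‖R.context t ω a‖ ≤ 1) (T : ℕ) :
    ∑ t ∈ Finset.range T, ∫ ω, width (R.history f t ω) (R.playedContext t ω) ∂P ≤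
      2 * (d * Real.log (d + T)) := by
  have hi := fun t => hR.integrable_width_playedContext hf hx t
  rw [← integral_finsetSum _ fun t _ => hi t]
  calc ∫ ω, ∑ t ∈ Finset.range T, width (R.history f t ω) (R.playedContext t ω) ∂P
      ≤ ∫ _ω, 2 * (d * Real.log (d + T)) ∂P := by
        refine integral_mono_ae (integrable_finsetSum _ fun t _ => hi t) (integrable_const _) ?_
        filter_upwards [ae_norm_context_le hx] with ω hω
        exact R.sum_width_le f T ω fun t => hω t _
    _ = _ := by simp

/-! ### Regret of one round and of all rounds -/

theorem integrable_sum_fairPolicy_mul_inner (hR : R.IsFairXLinTS P f env) (hf : Measurable f)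
    (hf0 : ∀ y, 0 < f y) (hx : ∀ t a, ∀ᵐ ω ∂P, ‖R.context t ω a‖ ≤ 1) (t : ℕ) {σ : Ω → Param d}
    (hσ : Measurable σ) :
    Integrable (fun ω => ∑ a, fairPolicy f (σ ω) (R.context t ω) a *
      ⟪R.trueParam ω, R.context t ω a⟫) P := by
  have hθ := hR.measurable_trueParam
  have hxm := hR.measurable_context t
  have hm : Measurable fun ω => ∑ a, fairPolicy f (σ ω) (R.context t ω) a *
      ⟪R.trueParam ω, R.context t ω a⟫ :=
    Finset.measurable_sum _ fun a _ => (measurable_fairPolicy hf hσ hxm a).mul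
      (hθ.inner ((measurable_pi_apply a).comp hxm))
  refine (hR.memLp_trueParam.integrable (by norm_num)).norm.mono' hm.aestronglyMeasurable ?_
  filter_upwards [ae_norm_context_le hx] with ω hω
  refine abs_sum_fairPolicy_mul_le hf0 _ _ (norm_nonneg _) fun a => ?_
  exact (abs_real_inner_le_norm _ _).trans (mul_le_of_le_one_right (norm_nonneg _) (hω t a))

/-- The learner expects under the sampled parameter what is earned under the true one. -/
theorem identDistrib_reward_sample (hR : R.IsFairXLinTS P f env) (hf : Measurable f)
    [∀ t, IsMarkovKernel (env t)] (t : ℕ) :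
    IdentDistrib (fun ω => ∑ a, R.policy f t ω a * ⟪R.sample t ω, R.context t ω a⟫)
      (fun ω => ∑ a, R.optPolicy f t ω a * ⟪R.trueParam ω, R.context t ω a⟫) P P := by
  have hm : Measurable fun p : Param d × History d K t × Contexts d K =>
      ∑ a, fairPolicy f p.1 p.2.2 a * ⟪p.1, p.2.2 a⟫ :=
    Finset.measurable_sum _ fun a _ =>
      (measurable_fairPolicy hf measurable_fst (by fun_prop) a).mul (by fun_prop)
  exact (hR.identDistrib_sample_trueParam hf t).comp hm

theorem identDistrib_ridgeError_sample (hR : R.IsFairXLinTS P f env) (hf : Measurable f)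
    [∀ t, IsMarkovKernel (env t)] (t : ℕ) :
    IdentDistrib (fun ω => ridgeError (R.history f t ω) (R.sample t ω))
      (fun ω => ridgeError (R.history f t ω) (R.trueParam ω)) P P := by
  have hm : Measurable fun p : Param d × History d K t × Contexts d K => ridgeError p.2.1 p.1 :=
    measurable_ridgeError (by fun_prop) measurable_fst
  exact (hR.identDistrib_sample_trueParam hf t).comp hm

/-- Cauchy-Schwarz produces widths averaged over all arms, whereas the elliptical potential controls
only the played one; the two agree in mean. -/
theorem integral_sum_policy_mul_width (hR : R.IsFairXLinTS P f env) (hf : Measurable f)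
    (hf0 : ∀ y, 0 < f y) (hx : ∀ t a, ∀ᵐ ω ∂P, ‖R.context t ω a‖ ≤ 1) (t : ℕ) :
    Integrable (fun ω => ∑ a, R.policy f t ω a *
        width (R.history f t ω) (R.context t ω a)) P ∧
      ∫ ω, ∑ a, R.policy f t ω a * width (R.history f t ω) (R.context t ω a) ∂P =
        ∫ ω, width (R.history f t ω) (R.playedContext t ω) ∂P := by
  have hH := hR.measurable_history hf t
  have hxm := hR.measurable_context t
  have hw1 : ∀ᵐ ω ∂P, ∀ a, |width (R.history f t ω) (R.context t ω a)| ≤ 1 := by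
    filter_upwards [ae_norm_context_le hx] with ω hω a
    rw [abs_of_nonneg (width_nonneg _ _)]
    exact (width_le_norm_sq _ _).trans (pow_le_one₀ (norm_nonneg _) (hω t _))
  constructor
  · have hm : Measurable fun ω => ∑ a, R.policy f t ω a *
        width (R.history f t ω) (R.context t ω a) :=
      Finset.measurable_sum _ fun a _ => ((measurable_pi_apply a).comp
        (hR.measurable_policy hf t)).mul (measurable_width hH ((measurable_pi_apply a).comp hxm))
    refine Integrable.of_bound hm.aestronglyMeasurable 1 ?_
    filter_upwards [hw1] with ω hω
    exact abs_sum_fairPolicy_mul_le hf0 _ _ zero_le_one hω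
  · have hm : ∀ a, Measurable fun p : History d K t × Contexts d K => width p.1 (p.2 a) :=
      fun a => measurable_width measurable_fst (by fun_prop)
    exact hR.integral_arm hf t (g := fun p a => width p.1 (p.2 a)) hm (c := 1)
      fun a => hw1.mono fun ω hω => hω a

theorem abs_integral_round_regret_le (hR : R.IsFairXLinTS P f env) (hf : Measurable f)
    (hf0 : ∀ y, 0 < f y) [∀ t, IsMarkovKernel (env t)]
    (hx : ∀ t a, ∀ᵐ ω ∂P, ‖R.context t ω a‖ ≤ 1) (t : ℕ) {l : ℝ} (hl : 0 < l) :
    |∫ ω, ∑ a, R.optPolicy f t ω a * ⟪R.trueParam ω, R.context t ω a⟫ ∂P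
      - ∫ ω, ∑ a, R.policy f t ω a * ⟪R.trueParam ω, R.context t ω a⟫ ∂P| ≤
      l * ∫ ω, ridgeError (R.history f t ω) (R.trueParam ω) ∂P
        + l⁻¹ * ∫ ω, width (R.history f t ω) (R.playedContext t ω) ∂P := by
  have h1 : Integrable (fun ω => ∑ a, R.optPolicy f t ω a *
      ⟪R.trueParam ω, R.context t ω a⟫) P :=
    hR.integrable_sum_fairPolicy_mul_inner hf hf0 hx t hR.measurable_trueParam
  have h3 : Integrable (fun ω => ∑ a, R.policy f t ω a *
      ⟪R.trueParam ω, R.context t ω a⟫) P :=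
    hR.integrable_sum_fairPolicy_mul_inner hf hf0 hx t (hR.measurable_sample t)
  have hidg := hR.identDistrib_reward_sample hf t
  have hidq := hR.identDistrib_ridgeError_sample hf t
  have hq := (hR.integral_ridgeError_le hf hx t).1
  have hqσ := hidq.integrable_iff.2 hq
  have h2 := hidg.integrable_iff.2 h1
  have hadd : Integrable (fun ω => ridgeError (R.history f t ω) (R.sample t ω)
      + ridgeError (R.history f t ω) (R.trueParam ω)) P := hqσ.add hq
  obtain ⟨hpw, hpw_eq⟩ := hR.integral_sum_policy_mul_width hf hf0 hx t
  -- Posterior matching replaces the optimal reward by the one predicted from the sample, so both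
  -- terms now carry the same policy.
  rw [← hidg.integral_eq, ← integral_sub h2 h3]
  calc _ ≤ ∫ ω, |∑ a, R.policy f t ω a * ⟪R.sample t ω, R.context t ω a⟫
          - ∑ a, R.policy f t ω a * ⟪R.trueParam ω, R.context t ω a⟫| ∂P :=
        abs_integral_le_integral_abs
    _ ≤ ∫ ω, (l / 2 * (ridgeError (R.history f t ω) (R.sample t ω)
          + ridgeError (R.history f t ω) (R.trueParam ω))
          + l⁻¹ * ∑ a, R.policy f t ω a * width (R.history f t ω) (R.context t ω a)) ∂P :=
        integral_mono (h2.sub h3).abs ((hadd.const_mul _).add (hpw.const_mul _)) fun ω =>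
          abs_sum_fairPolicy_mul_inner_sub_le hf0 (R.history f t ω) _ _ _ hl
    _ = _ := by
        rw [integral_add (hadd.const_mul _) (hpw.const_mul _), integral_const_mul,
          integral_const_mul, integral_add hqσ hq, hidq.integral_eq, hpw_eq]
        ring

theorem integrable_rewardRegret (hR : R.IsFairXLinTS P f env) (hf : Measurable f)
    (hf0 : ∀ y, 0 < f y) (hx : ∀ t a, ∀ᵐ ω ∂P, ‖R.context t ω a‖ ≤ 1) (T : ℕ) :
    Integrable (R.rewardRegret f T) P :=
  (integrable_finsetSum _ fun t _ =>
    hR.integrable_sum_fairPolicy_mul_inner hf hf0 hx t hR.measurable_trueParam).sub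
  (integrable_finsetSum _ fun t _ =>
    hR.integrable_sum_fairPolicy_mul_inner hf hf0 hx t (hR.measurable_sample t))

theorem abs_bayesRewardRegret_le (hR : R.IsFairXLinTS P f env) (hf : Measurable f)
    (hf0 : ∀ y, 0 < f y) [∀ t, IsMarkovKernel (env t)]
    (hx : ∀ t a, ∀ᵐ ω ∂P, ‖R.context t ω a‖ ≤ 1) (T : ℕ) :
    |R.bayesRewardRegret P f T| ≤ d * Real.sqrt T * (1 + 4 * Real.log (d + T)) := by
  rcases Nat.eq_zero_or_pos T with rfl | hT
  · simp [bayesRewardRegret, rewardRegret]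
  have hT' : (0 : ℝ) < Real.sqrt T := Real.sqrt_pos.2 (by exact_mod_cast hT)
  -- Over `T` rounds the bound is `l T` times the ridge error plus `l⁻¹` times the total width, both
  -- of order `d` up to logarithms; hence `l = 1 / √T`.
  have h := fun t => hR.abs_integral_round_regret_le hf hf0 hx t (inv_pos.2 hT')
  have hw := hR.sum_integral_width_le hf hx T
  have hw0 : ∀ t, 0 ≤ ∫ ω, width (R.history f t ω) (R.playedContext t ω) ∂P := fun t =>
    integral_nonneg fun ω => width_nonneg _ _
  have hq : ∀ t ∈ Finset.range T, ∫ ω, ridgeError (R.history f t ω) (R.trueParam ω) ∂P ≤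
      d + 2 * (d * Real.log (d + T)) := by
    intro t ht
    refine (hR.integral_ridgeError_le hf hx t).2.trans ?_
    gcongr
    refine le_trans (Finset.sum_le_sum_of_subset_of_nonneg ?_ fun s _ _ => hw0 s) hw
    exact Finset.range_subset_range.2 (Finset.mem_range.1 ht).le
  have e : R.bayesRewardRegret P f T = ∑ t ∈ Finset.range T,
      (∫ ω, ∑ a, R.optPolicy f t ω a * ⟪R.trueParam ω, R.context t ω a⟫ ∂P
        - ∫ ω, ∑ a, R.policy f t ω a * ⟪R.trueParam ω, R.context t ω a⟫ ∂P) := by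
    have h1 := fun t =>
      hR.integrable_sum_fairPolicy_mul_inner hf hf0 hx t hR.measurable_trueParam
    have h2 := fun t =>
      hR.integrable_sum_fairPolicy_mul_inner hf hf0 hx t (hR.measurable_sample t)
    simp only [bayesRewardRegret, rewardRegret, optPolicy, policy]
    rw [integral_sub (integrable_finsetSum _ fun t _ => h1 t)
      (integrable_finsetSum _ fun t _ => h2 t), integral_finsetSum _ fun t _ => h1 t,
      integral_finsetSum _ fun t _ => h2 t, Finset.sum_sub_distrib]
  rw [e]
  calc _ ≤ ∑ t ∈ Finset.range T, ((Real.sqrt T)⁻¹ * (d + 2 * (d * Real.log (d + T)))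
          + Real.sqrt T * ∫ ω, width (R.history f t ω) (R.playedContext t ω) ∂P) := by
        refine (Finset.abs_sum_le_sum_abs _ _).trans (Finset.sum_le_sum fun t ht => ?_)
        refine (h t).trans ?_
        rw [inv_inv]
        gcongr
        exact hq t ht
    _ = (T * (Real.sqrt T)⁻¹) * (d + 2 * (d * Real.log (d + T))) + Real.sqrt T *
          ∑ t ∈ Finset.range T, ∫ ω, width (R.history f t ω) (R.playedContext t ω) ∂P := by
        rw [Finset.sum_add_distrib, Finset.sum_const, Finset.card_range, nsmul_eq_mul,
          Finset.mul_sum, mul_assoc]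
    _ ≤ Real.sqrt T * (d + 2 * (d * Real.log (d + T)))
          + Real.sqrt T * (2 * (d * Real.log (d + T))) := by
        rw [← div_eq_mul_inv, Real.div_sqrt]
        gcongr
    _ = _ := by ring

end IsFairXLinTS

end FairX.Run

theorem log_add_le_one_add_log_mul {a b : ℝ} (ha : 1 ≤ a) (hb : 1 ≤ b) :
    Real.log (a + b) ≤ 1 + Real.log (a * b) := by
  -- From `(a - 1) (b - 1) ≥ 0`, `a + b ≤ 1 + a b ≤ 2 a b`; then `log 2 < 1`.
  have h1 : a + b ≤ 2 * (a * b) := by nlinarith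
  have h2 := Real.log_le_log (by linarith) h1
  rw [Real.log_mul two_ne_zero (by positivity)] at h2
  linarith [Real.log_two_lt_d9]

theorem theorem11 :
    ∃ (C : ℝ) (p : ℕ), ∀ (d K : ℕ) (f : ℝ → ℝ), Measurable f → (∀ y, 0 < f y) →
      ∀ (env : (t : ℕ) → Kernel (FairX.History d K t) (FairX.Contexts d K)),
      (∀ t, IsMarkovKernel (env t)) →
      ∀ (Ω : Type*) [MeasurableSpace Ω] (P : Measure Ω) [IsProbabilityMeasure P]
        (R : FairX.Run d K Ω), R.IsFairXLinTS P f env →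
      (∀ t a, ∀ᵐ ω ∂P, ‖R.context t ω a‖ ≤ 1) →
      ∀ T : ℕ, Integrable (R.rewardRegret f T) P ∧
        |R.bayesRewardRegret P f T| ≤
          C * (d * Real.sqrt T) * (1 + Real.log (d * T)) ^ p := by
  -- With `L = log (d T) ≥ 0`, `1 + 4 log (d + T) ≤ 1 + 4 (1 + L) ≤ 5 (1 + L)`.
  refine ⟨5, 1, ?_⟩
  intro d K f hf hf0 env henv Ω _ P _ R hR hx T
  refine ⟨hR.integrable_rewardRegret hf hf0 hx T, (hR.abs_bayesRewardRegret_le hf hf0 hx T).trans ?_⟩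
  rcases Nat.eq_zero_or_pos d with rfl | hd
  · simp
  rcases Nat.eq_zero_or_pos T with rfl | hT
  · simp
  have hd1 : (1 : ℝ) ≤ d := by exact_mod_cast hd
  have hT1 : (1 : ℝ) ≤ T := by exact_mod_cast hT
  have h1 := log_add_le_one_add_log_mul hd1 hT1
  have h2 : 0 ≤ Real.log (d * T : ℝ) := Real.log_nonneg (one_le_mul_of_one_le_of_one_le hd1 hT1)
  calc d * Real.sqrt T * (1 + 4 * Real.log (d + T))
      ≤ d * Real.sqrt T * (5 * (1 + Real.log (d * T))) :=
        mul_le_mul_of_nonneg_left (by linarith) (by positivity)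
    _ = _ := by ring
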